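/- For a finite simple connected graph $G$ and a real number $\alpha$, let $Pl_\alpha(G)=\sum_{uv\in E(G)}(d_u+d_v-2)^{\alpha}$ be the general Platt index, where $d_u$ is the degree of the vertex $u$. A connected graph with $n$ vertices and $m$ edges is called a tree, or a unicyclic, bicyclic, tricyclic, tetracyclic graph, if $m=n-1$, $n$, $n+1$, $n+2$, $n+3$, respectively. Let $S_n$ be the $n$-vertex star ($n\ge 1$), and define $n$-vertex graphs by adding edges between pendent vertices of $S_n$ (that is, between vertices other than the centre) as follows: $S_n^+$ ($n\ge 3$) by adding one edge; $B_1$ ($n\ge 4$) by adding the two edges of a path on three vertices; $G_4$ ($n\ge 5$) by adding three edges that join one vertex to three others (a star $K_{1,3}$); $G_5$ ($n\ge 4$) by adding the three edges of a triangle; $H_4$ ($n\ge 6$) by adding four edges that join one vertex to four others (a star $K_{1,4}$); $H_5$ ($n\ge 5$) by adding the three edges of a triangle and one edge joining a vertex of this triangle to a fourth vertex. Let $\alpha\ge 1$ be a real number. 1. The graphs $S_n$ ($n\ge 1$), $S_n^+$ ($n\ge 3$) and $B_1$ ($n\ge 4$) have the maximum value of $Pl_\alpha$ among the $n$-vertex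 trees, unicyclic graphs and bicyclic graphs, respectively. 2. For $n\ge 5$, either $G_4$ or $G_5$ has the maximum value of $Pl_\alpha$ among the $n$-vertex tricyclic graphs. More precisely, for $n\ge5$, \[ \begin{array}{ll} Pl_\alpha(G_4)<Pl_\alpha(G_5) & \text{if } 1<\alpha<2,\\ Pl_\alpha(G_4)>Pl_\alpha(G_5) & \text{if } \alpha>2,\\ Pl_\alpha(G_4)=Pl_\alpha(G_5) & \text{if } \alpha=1 \text{ or } \alpha=2. \end{array} \] 3. Among the $n$-vertex tetracyclic graphs, $H_4$ has the maximum value of $Pl_\alpha$ if $n\ge 6$, and $H_5$ has the maximum value of $Pl_\alpha$ if $n=5$. -/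

import Mathlib

universe u

open Classical in
/-- The general Platt index `Pl_α(G) = ∑_{uv ∈ E(G)} (d_u + d_v - 2) ^ α`. -/
noncomputable def plattIndex {V : Type*} [Fintype V] (α : ℝ) (G : SimpleGraph V) : ℝ :=
  ∑ e ∈ G.edgeFinset,
    Sym2.lift ⟨fun u v => ((G.degree u : ℝ) + (G.degree v : ℝ) - 2) ^ α,
      fun u v => by simp only [add_comm (G.degree u : ℝ)]⟩ e

/-- A connected graph with `n` vertices and `n - 1 + k` edges: a tree for `k = 0`, and a unicyclic,
bicyclic, tricyclic, tetracyclic graph for `k = 1, 2, 3, 4`, respectively. -/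
def IsCyclicGraph {V : Type*} [Fintype V] (k : ℕ) (G : SimpleGraph V) : Prop :=
  G.Connected ∧ G.edgeSet.ncard + 1 = Fintype.card V + k

/-- `G₀` has the maximum value of `Pl_α` among all `n`-vertex connected graphs with
`n - 1 + k` edges. -/
def HasMaxPlatt (α : ℝ) (k n : ℕ) (G₀ : SimpleGraph (Fin n)) : Prop :=
  IsCyclicGraph k G₀ ∧
    ∀ (V : Type u) [Fintype V] (G : SimpleGraph V),
      Fintype.card V = n → IsCyclicGraph k G → plattIndex α G ≤ plattIndex α G₀

/-- The star on the vertices `0, …, n - 1` with centre `0`, together with the edges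
listed in `L`. -/
def starWith (n : ℕ) (L : List (ℕ × ℕ)) : SimpleGraph (Fin n) :=
  SimpleGraph.fromRel fun u v : Fin n => u.val = 0 ∨ (u.val, v.val) ∈ L

/-- The star `S_n`. -/
def graphS (n : ℕ) : SimpleGraph (Fin n) := starWith n []

/-- The graph `S_n⁺`: the star plus one edge (for `n ≥ 3`). -/
def graphSPlus (n : ℕ) : SimpleGraph (Fin n) := starWith n [(1, 2)]

/-- The graph `B_1`: the star plus the two edges of a path on three pendent vertices
(for `n ≥ 4`). -/
def graphB1 (n : ℕ) : SimpleGraph (Fin n) := starWith n [(1, 2), (1, 3)]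

/-- The graph `G_4`: the star plus three edges from one pendent vertex to three others
(for `n ≥ 5`). -/
def graphG4 (n : ℕ) : SimpleGraph (Fin n) := starWith n [(1, 2), (1, 3), (1, 4)]

/-- The graph `G_5`: the star plus the three edges of a triangle on pendent vertices
(for `n ≥ 4`). -/
def graphG5 (n : ℕ) : SimpleGraph (Fin n) := starWith n [(1, 2), (1, 3), (2, 3)]

/-- The graph `H_4`: the star plus four edges from one pendent vertex to four others
(for `n ≥ 6`). -/
def graphH4 (n : ℕ) : SimpleGraph (Fin n) := starWith n [(1, 2), (1, 3), (1, 4), (1, 5)]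

/-- The graph `H_5`: the star plus the four edges of a triangle with a pendent edge on
pendent vertices (for `n ≥ 5`). -/
def graphH5 (n : ℕ) : SimpleGraph (Fin n) := starWith n [(1, 2), (1, 3), (2, 3), (1, 4)]

/-! The proof compresses graphs. Moving the private neighbours of `b` to a vertex `a` of at least
the same degree keeps the number of edges and, by convexity of `x ^ α` for `α ≥ 1`, does not
decrease the index (`plattIndex_le_compress`). It keeps the graph connected when `a` and `b` are
adjacent or have a common neighbour. Among the graphs that dominate a given one, a maximiser of the
sum of squared degrees admits no proper compression of this kind. With its vertices sorted by
degree, it is a star plus a set of pairs `i < j` of pendent vertices closed under lowering indices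
(`IsCyclicGraph.exists_isShifted`).

There is one such set of `k` pairs for `k ≤ 2`, and there are at most two for `k = 3, 4`. The
remaining comparisons of `G_4` with `G_5` and of `H_4` with `H_5` reduce to second differences of `x
^ α`. -/

/-! ### The index as a sum over ordered pairs. -/

open Classical in
lemma two_mul_plattIndex {V : Type*} [Fintype V] (α : ℝ) (G : SimpleGraph V) :
    2 * plattIndex α G = ∑ u, ∑ v,
      if G.Adj u v then ((G.degree u : ℝ) + (G.degree v : ℝ) - 2) ^ α else 0 := by
  set w : Sym2 V → ℝ := Sym2.lift ⟨fun u v => ((G.degree u : ℝ) + (G.degree v : ℝ) - 2) ^ α,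
      fun u v => by simp only [add_comm (G.degree u : ℝ)]⟩ with hw
  -- Every edge underlies exactly two darts.
  have h1 : ∑ d : G.Dart, w d.edge = 2 * plattIndex α G := by
    rw [← Finset.sum_fiberwise_of_maps_to (s := Finset.univ) (t := G.edgeFinset)
      (g := fun d : G.Dart => d.edge) (by simp [SimpleGraph.Dart.edge_mem]),
      plattIndex, Finset.mul_sum]
    refine Finset.sum_congr rfl fun e he => ?_
    rw [Finset.sum_congr rfl (g := fun _ => w e)
      (fun d hd => by rw [(Finset.mem_filter.1 hd).2]), Finset.sum_const,
      G.dart_edge_fiber_card e (by simpa using he)]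
    simp [hw]
  rw [← h1, ← Finset.sum_product', ← Finset.sum_filter]
  refine Finset.sum_bij (fun d _ => d.toProd) ?_ ?_ ?_ ?_
  · intro d _; simp [d.adj]
  · intro d _ d' _ h; exact SimpleGraph.Dart.ext _ _ h
  · rintro ⟨a, b⟩ h
    simp only [Finset.mem_filter] at h
    exact ⟨⟨(a, b), h.2⟩, Finset.mem_univ _, rfl⟩
  · intro d _; simp [hw, SimpleGraph.Dart.edge]

lemma plattIndex_congr_iso {V W : Type*} [Fintype V] [Fintype W] (α : ℝ) {G : SimpleGraph V}
    {H : SimpleGraph W} (e : G ≃g H) : plattIndex α G = plattIndex α H := by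
  classical
  have h : (2 : ℝ) * plattIndex α G = 2 * plattIndex α H := by
    rw [two_mul_plattIndex, two_mul_plattIndex, ← e.toEquiv.sum_comp]
    refine Finset.sum_congr rfl fun u _ => ?_
    rw [← e.toEquiv.sum_comp]
    refine Finset.sum_congr rfl fun v _ => ?_
    have hd (x : V) : H.degree (e x) = G.degree x := e.degree_eq x
    have h1 : H.Adj (e.toEquiv u) (e.toEquiv v) ↔ G.Adj u v := e.map_rel_iff
    simp only [h1]
    change _ = if _ then ((H.degree (e u) : ℝ) + (H.degree (e v) : ℝ) - 2) ^ α else 0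
    rw [hd, hd]
  linarith

lemma IsCyclicGraph.congr_iso {V W : Type*} [Fintype V] [Fintype W] {k : ℕ} {G : SimpleGraph V}
    {H : SimpleGraph W} (e : G ≃g H) (h : IsCyclicGraph k G) : IsCyclicGraph k H := by
  refine ⟨e.connected_iff.1 h.1, ?_⟩
  rw [← Fintype.card_congr e.toEquiv, ← h.2, Set.ncard_congr' e.mapEdgeSet]

/-! ### Compression. -/

/-- Both `x` and `y` are convex combinations of `x + s` and `y - s`, with the weights `1 - t, t`
interchanged; the two convexity inequalities add up to the claim. -/
lemma rpow_add_le_of_spread {α x y s : ℝ} (hα : 1 ≤ α) (hy : 0 ≤ y - s) (hs : 0 ≤ s)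
    (hxy : y ≤ x) : x ^ α + y ^ α ≤ (x + s) ^ α + (y - s) ^ α := by
  have hc := convexOn_rpow hα
  rcases hs.eq_or_lt with rfl | hs
  · simp
  have hD : 0 < x - y + 2 * s := by linarith
  set t : ℝ := s / (x - y + 2 * s) with ht
  have ht0 : 0 ≤ t := by positivity
  have ht1 : t ≤ 1 := by rw [ht, div_le_one hD]; linarith
  have htD : t * (x - y + 2 * s) = s := div_mul_cancel₀ _ hD.ne'
  have hX : x + s ∈ Set.Ici (0 : ℝ) := by simp only [Set.mem_Ici]; linarith
  have hY : y - s ∈ Set.Ici (0 : ℝ) := hy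
  have h1 := hc.2 hX hY (sub_nonneg.2 ht1) ht0 (by ring)
  have h2 := hc.2 hX hY ht0 (sub_nonneg.2 ht1) (by ring)
  simp only [smul_eq_mul] at h1 h2
  rw [show (1 - t) * (x + s) + t * (y - s) = x by linear_combination -htD] at h1
  rw [show t * (x + s) + (1 - t) * (y - s) = y by linear_combination htD] at h2
  linarith

/-- The compression of `G` from `b` to `a`: the private neighbours of `b` become neighbours
of `a`. -/
def SimpleGraph.compress {V : Type*} (G : SimpleGraph V) (a b : V) : SimpleGraph V :=
  SimpleGraph.fromRel fun x y =>
    (x ≠ a ∧ x ≠ b ∧ y ≠ a ∧ y ≠ b ∧ G.Adj x y) ∨ (x = a ∧ y = b ∧ G.Adj a b) ∨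
    (x = a ∧ y ≠ a ∧ y ≠ b ∧ (G.Adj a y ∨ G.Adj b y)) ∨
    (x = b ∧ y ≠ a ∧ y ≠ b ∧ G.Adj a y ∧ G.Adj b y)

section Compress
variable {V : Type*} {G : SimpleGraph V} {a b : V}

lemma SimpleGraph.compress_adj_of_ne {x y : V} (hx : x ≠ a ∧ x ≠ b) (hy : y ≠ a ∧ y ≠ b) :
    (G.compress a b).Adj x y ↔ G.Adj x y := by
  have := G.adj_comm x y
  have := G.ne_of_adj (a := x) (b := y)
  simp only [SimpleGraph.compress, SimpleGraph.fromRel_adj]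
  grind

lemma SimpleGraph.compress_adj_pair (hab : a ≠ b) :
    (G.compress a b).Adj a b ↔ G.Adj a b := by
  simp only [SimpleGraph.compress, SimpleGraph.fromRel_adj]
  grind

lemma SimpleGraph.compress_adj_left {y : V} (hab : a ≠ b) (hy : y ≠ a ∧ y ≠ b) :
    (G.compress a b).Adj a y ↔ G.Adj a y ∨ G.Adj b y := by
  simp only [SimpleGraph.compress, SimpleGraph.fromRel_adj]
  grind

lemma SimpleGraph.compress_adj_right {y : V} (hab : a ≠ b) (hy : y ≠ a ∧ y ≠ b) :
    (G.compress a b).Adj b y ↔ G.Adj a y ∧ G.Adj b y := by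
  simp only [SimpleGraph.compress, SimpleGraph.fromRel_adj]
  grind

/-- Ends of an old edge stay mutually reachable once `a` and `b` are. The hypothesis `h` ensures
this: without it `b` would become isolated. -/
lemma SimpleGraph.connected_compress (hG : G.Connected) (hab : a ≠ b)
    (h : G.Adj a b ∨ ∃ c, G.Adj a c ∧ G.Adj b c) : (G.compress a b).Connected := by
  have hAB : (G.compress a b).Reachable a b := by
    by_cases hadj : G.Adj a b
    · exact ((compress_adj_pair hab).2 hadj).reachable
    · obtain ⟨c, hac, hbc⟩ := h.resolve_left hadj
      have hc : c ≠ a ∧ c ≠ b := ⟨hac.ne', hbc.ne'⟩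
      exact ((compress_adj_left hab hc).2 (.inl hac)).reachable.trans
        ((compress_adj_right hab hc).2 ⟨hac, hbc⟩).reachable.symm
  have key : ∀ x y, G.Adj x y → (G.compress a b).Reachable x y := by
    have hA : ∀ y, G.Adj a y → (G.compress a b).Reachable a y := by
      intro y hy
      by_cases hyb : y = b
      · exact hyb ▸ hAB
      · exact ((compress_adj_left hab ⟨hy.ne', hyb⟩).2 (.inl hy)).reachable
    have hB : ∀ y, G.Adj b y → (G.compress a b).Reachable b y := by
      intro y hy
      by_cases hya : y = a
      · exact hya ▸ hAB.symm
      · exact hAB.symm.trans ((compress_adj_left hab ⟨hya, hy.ne'⟩).2 (.inr hy)).reachable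
    intro x y hxy
    by_cases hxa : x = a
    · subst hxa; exact hA _ hxy
    by_cases hxb : x = b
    · subst hxb; exact hB _ hxy
    by_cases hya : y = a
    · subst hya; exact (hA _ hxy.symm).symm
    by_cases hyb : y = b
    · subst hyb; exact (hB _ hxy.symm).symm
    exact ((compress_adj_of_ne ⟨hxa, hxb⟩ ⟨hya, hyb⟩).2 hxy).reachable
  have := hG.nonempty
  refine ⟨fun u v => ?_⟩
  obtain ⟨p⟩ := hG.preconnected u v
  induction p with
  | nil => exact .refl _
  | cons h _ ih => exact (key _ _ h).trans ih

variable [Fintype V]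

open Classical in
lemma SimpleGraph.degree_eq_sum_erase_pair (H : SimpleGraph V) (hab : a ≠ b) (x : V) :
    H.degree x = (if H.Adj x a then 1 else 0) + (if H.Adj x b then 1 else 0) +
      ∑ y ∈ (Finset.univ.erase a).erase b, if H.Adj x y then 1 else 0 := by
  have h := H.degree_eq_sum_if_adj (R := ℕ) x
  rw [Nat.cast_id] at h
  rw [h, ← Finset.add_sum_erase _ _ (Finset.mem_univ a),
    ← Finset.add_sum_erase (Finset.univ.erase a) _
      (Finset.mem_erase.2 ⟨hab.symm, Finset.mem_univ b⟩), add_assoc]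

open Classical in
lemma SimpleGraph.sum_sum_erase_pair (hab : a ≠ b) (g : V → V → ℝ) (hg : ∀ x y, g x y = g y x)
    (h0 : ∀ x, g x x = 0) :
    ∑ x, ∑ y, g x y = 2 * g a b + 2 * ∑ y ∈ (Finset.univ.erase a).erase b, (g a y + g b y) +
      ∑ x ∈ (Finset.univ.erase a).erase b, ∑ y ∈ (Finset.univ.erase a).erase b, g x y := by
  have h (f : V → ℝ) : ∑ x, f x = f a + f b + ∑ x ∈ (Finset.univ.erase a).erase b, f x := by
    rw [← Finset.add_sum_erase _ _ (Finset.mem_univ a),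
      ← Finset.add_sum_erase (Finset.univ.erase a) _
        (Finset.mem_erase.2 ⟨hab.symm, Finset.mem_univ b⟩), add_assoc]
  simp only [h, Finset.sum_add_distrib, h0]
  rw [hg b a, Finset.sum_congr rfl fun x _ => hg x a, Finset.sum_congr rfl fun x _ => hg x b]
  ring

open Classical in
/-- The number of private neighbours of `b` with respect to `a`. -/
noncomputable def SimpleGraph.privateCount (G : SimpleGraph V) (a b : V) : ℕ :=
  ∑ y ∈ (Finset.univ.erase a).erase b, if G.Adj b y ∧ ¬ G.Adj a y then 1 else 0

open Classical in
lemma SimpleGraph.degree_compress_left (hab : a ≠ b) :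
    (G.compress a b).degree a = G.degree a + G.privateCount a b := by
  rw [degree_eq_sum_erase_pair _ hab, degree_eq_sum_erase_pair _ hab, privateCount, add_assoc (_ + _),
    ← Finset.sum_add_distrib]
  simp only [SimpleGraph.irrefl, compress_adj_pair hab, if_false]
  congr 1
  refine Finset.sum_congr rfl fun y hy => ?_
  simp only [Finset.mem_erase, Finset.mem_univ, and_true] at hy
  simp only [compress_adj_left hab hy.symm]
  by_cases h1 : G.Adj a y <;> by_cases h2 : G.Adj b y <;> simp [h1, h2]

open Classical in
lemma SimpleGraph.degree_compress_right (hab : a ≠ b) :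
    (G.compress a b).degree b + G.privateCount a b = G.degree b := by
  rw [degree_eq_sum_erase_pair _ hab, degree_eq_sum_erase_pair _ hab, privateCount, add_assoc (_ + _),
    ← Finset.sum_add_distrib]
  simp only [SimpleGraph.irrefl, (G.compress a b).adj_comm b a, compress_adj_pair hab,
    G.adj_comm b a]
  congr 1
  refine Finset.sum_congr rfl fun y hy => ?_
  simp only [Finset.mem_erase, Finset.mem_univ, and_true] at hy
  simp only [compress_adj_right hab hy.symm]
  by_cases h1 : G.Adj a y <;> by_cases h2 : G.Adj b y <;> simp [h1, h2]

open Classical in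
lemma SimpleGraph.degree_compress_of_ne (hab : a ≠ b) {x : V} (hx : x ≠ a ∧ x ≠ b) :
    (G.compress a b).degree x = G.degree x := by
  rw [degree_eq_sum_erase_pair _ hab, degree_eq_sum_erase_pair _ hab]
  congr 1
  · rw [(G.compress a b).adj_comm x a, (G.compress a b).adj_comm x b]
    simp only [compress_adj_left hab hx, compress_adj_right hab hx, G.adj_comm x a, G.adj_comm x b]
    by_cases h1 : G.Adj a x <;> by_cases h2 : G.Adj b x <;> simp [h1, h2]
  · refine Finset.sum_congr rfl fun y hy => ?_
    simp only [Finset.mem_erase, Finset.mem_univ, and_true] at hy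
    simp only [compress_adj_of_ne hx hy.symm]

-- Write `s` for the number of moved neighbours. The edge `ab` keeps its weight because `d_a + d_b`
-- is preserved, and edges avoiding both vertices are unchanged. At a common neighbour the two bases
-- are spread apart by `s`. At a private neighbour of either vertex the single base grows.
open Classical in
lemma plattIndex_le_compress {α : ℝ} (hα : 1 ≤ α) (hab : a ≠ b) (hd : G.degree b ≤ G.degree a) :
    plattIndex α G ≤ plattIndex α (G.compress a b) := by
  have hα0 : 0 ≤ α := by linarith
  suffices h : 2 * plattIndex α G ≤ 2 * plattIndex α (G.compress a b) by linarith
  have hsym (H : SimpleGraph V) : ∀ x y,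
      (if H.Adj x y then ((H.degree x : ℝ) + (H.degree y : ℝ) - 2) ^ α else 0) =
      if H.Adj y x then ((H.degree y : ℝ) + (H.degree x : ℝ) - 2) ^ α else 0 := by
    intro x y; rw [H.adj_comm x y, add_comm (H.degree x : ℝ)]
  rw [two_mul_plattIndex, two_mul_plattIndex,
    SimpleGraph.sum_sum_erase_pair hab _ (hsym _) (by simp),
    SimpleGraph.sum_sum_erase_pair hab _ (hsym _) (by simp)]
  have hl : ((G.compress a b).degree a : ℝ) = G.degree a + G.privateCount a b := by
    rw [SimpleGraph.degree_compress_left hab]; push_cast; ring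
  have hr : ((G.compress a b).degree b : ℝ) = G.degree b - G.privateCount a b := by
    rw [← SimpleGraph.degree_compress_right (G := G) hab]; push_cast; ring
  have hd' : (G.degree b : ℝ) ≤ G.degree a := by exact_mod_cast hd
  have hs0 : (0 : ℝ) ≤ G.privateCount a b := by positivity
  have hpos (H : SimpleGraph V) {x y : V} (h : H.Adj x y) : (1 : ℝ) ≤ H.degree x := by
    exact_mod_cast Nat.one_le_iff_ne_zero.2 (Nat.pos_iff_ne_zero.1 h.degree_pos_left)
  simp only [SimpleGraph.compress_adj_pair hab, hl, hr]
  refine add_le_add (add_le_add (le_of_eq ?_) ?_) (le_of_eq ?_)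
  · congr 3; ring
  · refine mul_le_mul_of_nonneg_left (Finset.sum_le_sum fun y hy => ?_) (by norm_num)
    simp only [Finset.mem_erase, Finset.mem_univ, and_true] at hy
    have hy := hy.symm
    simp only [SimpleGraph.compress_adj_left hab hy, SimpleGraph.compress_adj_right hab hy,
      SimpleGraph.degree_compress_of_ne hab hy]
    by_cases h1 : G.Adj a y <;> by_cases h2 : G.Adj b y
    · have := hpos _ ((SimpleGraph.compress_adj_right hab hy).2 ⟨h1, h2⟩)
      have := hpos _ h1.symm
      simp only [h1, h2, or_self, and_self, if_true]
      have h := rpow_add_le_of_spread (x := G.degree a + G.degree y - 2)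
        (y := G.degree b + G.degree y - 2) hα (by linarith) hs0 (by linarith)
      exact h.trans_eq (by congr 2 <;> ring)
    · have := hpos _ h1
      have := hpos _ h1.symm
      simp only [h1, h2, or_false, and_false, if_true, if_false, add_zero]
      exact Real.rpow_le_rpow (by linarith) (by linarith) hα0
    · have := hpos _ h2
      have := hpos _ h2.symm
      simp only [h1, h2, or_true, false_and, if_true, if_false, add_zero, zero_add]
      exact Real.rpow_le_rpow (by linarith) (by linarith) hα0
    · simp [h1, h2]
  · refine Finset.sum_congr rfl fun x hx => Finset.sum_congr rfl fun y hy => ?_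
    simp only [Finset.mem_erase, Finset.mem_univ, and_true] at hx hy
    simp only [SimpleGraph.compress_adj_of_ne hx.symm hy.symm,
      SimpleGraph.degree_compress_of_ne hab hx.symm, SimpleGraph.degree_compress_of_ne hab hy.symm]

-- Only the degrees of `a` and `b` change. The case `f = id` gives the edge count, and `f = (· ^ 2)`
-- the potential that rules out further compressions.
open Classical in
lemma SimpleGraph.sum_degree_compress (hab : a ≠ b) (f : ℕ → ℕ) :
    ∑ x, f ((G.compress a b).degree x) + f (G.degree a) + f (G.degree b) =
    ∑ x, f (G.degree x) + f ((G.compress a b).degree a) + f ((G.compress a b).degree b) := by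
  have h (g : V → ℕ) : ∑ x, g x = g a + g b + ∑ x ∈ (Finset.univ.erase a).erase b, g x := by
    rw [← Finset.add_sum_erase _ _ (Finset.mem_univ a),
      ← Finset.add_sum_erase (Finset.univ.erase a) _
        (Finset.mem_erase.2 ⟨hab.symm, Finset.mem_univ b⟩), add_assoc]
  rw [h, h]
  have : ∑ x ∈ (Finset.univ.erase a).erase b, f ((G.compress a b).degree x) =
      ∑ x ∈ (Finset.univ.erase a).erase b, f (G.degree x) := by
    refine Finset.sum_congr rfl fun x hx => ?_
    simp only [Finset.mem_erase, Finset.mem_univ, and_true] at hx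
    rw [degree_compress_of_ne hab hx.symm]
  rw [this]
  ring

lemma SimpleGraph.ncard_edgeSet_compress (hab : a ≠ b) :
    (G.compress a b).edgeSet.ncard = G.edgeSet.ncard := by
  classical
  have h1 := G.sum_degrees_eq_twice_card_edges
  have h2 := (G.compress a b).sum_degrees_eq_twice_card_edges
  have h3 := sum_degree_compress (G := G) hab id
  have h4 := degree_compress_left (G := G) hab
  have h5 := degree_compress_right (G := G) hab
  rw [← SimpleGraph.coe_edgeFinset, ← SimpleGraph.coe_edgeFinset, Set.ncard_coe_finset,
    Set.ncard_coe_finset]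
  simp only [id] at h3
  lia

open Classical in
/-- Every graph is dominated by a graph with nested neighbourhoods. -/
lemma IsCyclicGraph.exists_nested {α : ℝ} (hα : 1 ≤ α) {k : ℕ} (hG : IsCyclicGraph k G) :
    ∃ H : SimpleGraph V, IsCyclicGraph k H ∧ plattIndex α G ≤ plattIndex α H ∧
      ∀ a b, a ≠ b → H.degree b ≤ H.degree a → (H.Adj a b ∨ ∃ c, H.Adj a c ∧ H.Adj b c) →
        ∀ y, y ≠ a → H.Adj b y → H.Adj a y := by
  -- Moving `s > 0` neighbours raises the sum of squares by `2 * s * (d_a - d_b + s) > 0`, so a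
  -- maximiser has no private neighbours to move.
  obtain ⟨H, ⟨hH, hle⟩, hmax⟩ := Set.exists_max_image
    {H : SimpleGraph V | IsCyclicGraph k H ∧ plattIndex α G ≤ plattIndex α H}
    (fun H => ∑ x, H.degree x ^ 2) (Set.toFinite _) ⟨G, hG, le_rfl⟩
  refine ⟨H, hH, hle, fun a b hab hd hc y hya hby => ?_⟩
  by_contra hay
  have hmem : H.compress a b ∈
      {H : SimpleGraph V | IsCyclicGraph k H ∧ plattIndex α G ≤ plattIndex α H} :=
    ⟨⟨SimpleGraph.connected_compress hH.1 hab hc, by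
      rw [SimpleGraph.ncard_edgeSet_compress hab]; exact hH.2⟩,
      hle.trans (plattIndex_le_compress hα hab hd)⟩
  have h := hmax _ hmem
  have hs : 0 < H.privateCount a b := by
    refine Finset.sum_pos' (fun _ _ => Nat.zero_le _) ⟨y, ?_, ?_⟩
    · simp [hya, hby.ne']
    · simp [hby, hay]
  have h3 := SimpleGraph.sum_degree_compress (G := H) hab (· ^ 2)
  have h4 := SimpleGraph.degree_compress_left (G := H) hab
  have h5 := SimpleGraph.degree_compress_right (G := H) hab
  beta_reduce at h h3
  rw [h4, ← h5] at h3
  rw [← h5] at hd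
  nlinarith

end Compress

/-! ### Stars with added edges: size, degrees and index. -/

lemma starWith_adj {n : ℕ} {L : List (ℕ × ℕ)} {x y : Fin n} :
    (starWith n L).Adj x y ↔ x ≠ y ∧ ((x.val = 0 ∨ (x.val, y.val) ∈ L) ∨
      (y.val = 0 ∨ (y.val, x.val) ∈ L)) :=
  SimpleGraph.fromRel_adj _ _ _

/-- The edges in `L` are distinct edges between pendent vertices of the star `S_{m+1}`. -/
def ValidEdges (m : ℕ) (L : List (ℕ × ℕ)) : Prop :=
  L.Nodup ∧ ∀ p ∈ L, 1 ≤ p.1 ∧ p.1 < p.2 ∧ p.2 ≤ m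

-- With values in an arbitrary `M`, this one formula yields the number of edges, the degrees and the
-- index, for suitable weights.
open Classical in
lemma sum_edgeFinset_starWith {M : Type*} [AddCommMonoid M] {m : ℕ} {L : List (ℕ × ℕ)}
    (hL : ValidEdges m L) (w : Sym2 (Fin (m + 1)) → M) (φ : ℕ → ℕ → M)
    (hw : ∀ x y : Fin (m + 1), x.val < y.val → w s(x, y) = φ x y) :
    ∑ e ∈ (starWith (m + 1) L).edgeFinset, w e =
      ∑ i ∈ Finset.range m, φ 0 (i + 1) + (L.map fun p => φ p.1 p.2).sum := by
  induction L with
  | nil =>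
    have hE : (starWith (m + 1) []).edgeFinset =
        Finset.univ.image fun i : Fin m => s((0 : Fin (m + 1)), i.succ) := by
      ext e
      induction e with | _ x y
      simp only [SimpleGraph.mem_edgeFinset, SimpleGraph.mem_edgeSet, starWith_adj,
        Finset.mem_image, Finset.mem_univ, true_and, List.not_mem_nil, or_false, Sym2.eq_iff]
      constructor
      · rintro ⟨hxy, hx | hy⟩
        · obtain rfl : x = 0 := Fin.ext hx
          obtain ⟨i, rfl⟩ := Fin.exists_succ_eq.2 hxy.symm
          exact ⟨i, .inl ⟨rfl, rfl⟩⟩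
        · obtain rfl : y = 0 := Fin.ext hy
          obtain ⟨i, rfl⟩ := Fin.exists_succ_eq.2 hxy
          exact ⟨i, .inr ⟨rfl, rfl⟩⟩
      · rintro ⟨i, ⟨rfl, rfl⟩ | ⟨rfl, rfl⟩⟩
        · exact ⟨(Fin.succ_ne_zero i).symm, .inl rfl⟩
        · exact ⟨Fin.succ_ne_zero i, .inr rfl⟩
    rw [hE, Finset.sum_image, Finset.sum_range]
    · simp only [List.map_nil, List.sum_nil, add_zero]
      refine Finset.sum_congr rfl fun i _ => ?_
      rw [hw] <;> simp
    · intro i _ j _ h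
      simpa [Sym2.eq_iff] using h
  | cons p L ih =>
    obtain ⟨hnd, hp⟩ := hL
    rw [List.nodup_cons] at hnd
    have hL' : ValidEdges m L := ⟨hnd.2, fun q hq => hp q (List.mem_cons_of_mem _ hq)⟩
    obtain ⟨h1, h2, h3⟩ := hp p List.mem_cons_self
    let a : Fin (m + 1) := ⟨p.1, by lia⟩
    let b : Fin (m + 1) := ⟨p.2, by lia⟩
    have hE : (starWith (m + 1) (p :: L)).edgeFinset =
        insert s(a, b) (starWith (m + 1) L).edgeFinset := by
      ext e
      induction e with | _ x y
      have hxa : x = a ↔ x.val = p.1 := Fin.ext_iff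
      have hxb : x = b ↔ x.val = p.2 := Fin.ext_iff
      have hya : y = a ↔ y.val = p.1 := Fin.ext_iff
      have hyb : y = b ↔ y.val = p.2 := Fin.ext_iff
      have hxy : x = y ↔ x.val = y.val := Fin.ext_iff
      simp only [SimpleGraph.mem_edgeFinset, SimpleGraph.mem_edgeSet, starWith_adj,
        Finset.mem_insert, List.mem_cons, Sym2.eq_iff, Prod.ext_iff, hxa, hxb, hya, hyb, ne_eq, hxy]
      generalize ((x.val, y.val) ∈ L) = P
      generalize ((y.val, x.val) ∈ L) = Q
      constructor
      · rintro ⟨hn, (h | h | h) | h | h | h⟩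
        · exact .inr ⟨hn, .inl (.inl h)⟩
        · exact .inl (.inl h)
        · exact .inr ⟨hn, .inl (.inr h)⟩
        · exact .inr ⟨hn, .inr (.inl h)⟩
        · exact .inl (.inr ⟨h.2, h.1⟩)
        · exact .inr ⟨hn, .inr (.inr h)⟩
      · rintro ((h | h) | ⟨hn, (h | h) | h | h⟩)
        · exact ⟨by lia, .inl (.inr (.inl h))⟩
        · exact ⟨by lia, .inr (.inr (.inl ⟨h.2, h.1⟩))⟩
        · exact ⟨hn, .inl (.inl h)⟩
        · exact ⟨hn, .inl (.inr (.inr h))⟩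
        · exact ⟨hn, .inr (.inl h)⟩
        · exact ⟨hn, .inr (.inr (.inr h))⟩
    have hnot : s(a, b) ∉ (starWith (m + 1) L).edgeFinset := by
      simp only [SimpleGraph.mem_edgeFinset, SimpleGraph.mem_edgeSet, starWith_adj, a, b]
      rintro ⟨_, (h | h) | h | h⟩
      · lia
      · exact hnd.1 h
      · lia
      · have := (hL'.2 _ h).2.1
        simp only at this
        lia
    rw [hE, Finset.sum_insert hnot, ih hL', hw a b h2, List.map_cons, List.sum_cons]
    exact add_left_comm _ _ _

lemma ncard_edgeSet_starWith {m : ℕ} {L : List (ℕ × ℕ)} (hL : ValidEdges m L) :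
    (starWith (m + 1) L).edgeSet.ncard = m + L.length := by
  classical
  rw [← SimpleGraph.coe_edgeFinset, Set.ncard_coe_finset, Finset.card_eq_sum_ones,
    sum_edgeFinset_starWith hL _ (fun _ _ => 1) (fun _ _ _ => rfl)]
  simp

lemma connected_starWith (m : ℕ) (L : List (ℕ × ℕ)) : (starWith (m + 1) L).Connected := by
  refine SimpleGraph.Connected.of_isUniversal (v := 0) fun y hy => ?_
  exact starWith_adj.2 ⟨hy, .inl (.inl rfl)⟩

lemma isCyclicGraph_starWith {m : ℕ} {L : List (ℕ × ℕ)} (hL : ValidEdges m L) :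
    IsCyclicGraph L.length (starWith (m + 1) L) := by
  refine ⟨connected_starWith m L, ?_⟩
  rw [ncard_edgeSet_starWith hL, Fintype.card_fin]
  lia

/-- The number of pairs in `L` that contain `v`. -/
def incidence (L : List (ℕ × ℕ)) (v : ℕ) : ℕ :=
  (L.map fun p => if v = p.1 ∨ v = p.2 then 1 else 0).sum

open Classical in
lemma degree_starWith {m : ℕ} {L : List (ℕ × ℕ)} (hL : ValidEdges m L) (v : Fin (m + 1)) :
    (starWith (m + 1) L).degree v = (if v.val = 0 then m else 1) + incidence L v := by
  rw [← SimpleGraph.card_incidenceFinset_eq_degree, SimpleGraph.incidenceFinset_eq_filter,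
    Finset.card_filter,
    sum_edgeFinset_starWith hL _ (fun a b => if v.val = a ∨ v.val = b then 1 else 0)
      (fun x y _ => by simp only [Sym2.mem_iff, Fin.ext_iff])]
  congr 1
  split_ifs with hv
  · simp [hv]
  · have : ∀ i, (v.val = 0 ∨ v.val = i + 1) ↔ i = v.val - 1 := by lia
    simp only [this]
    rw [Finset.sum_ite_eq' (Finset.range m), if_pos]
    rw [Finset.mem_range]
    lia

lemma incidence_zero {m : ℕ} {L : List (ℕ × ℕ)} (hL : ValidEdges m L) : incidence L 0 = 0 := by
  rw [incidence, List.sum_eq_zero]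
  intro x hx
  obtain ⟨p, hp, rfl⟩ := List.mem_map.1 hx
  have := hL.2 p hp
  rw [if_neg (by lia)]

lemma plattIndex_starWith (α : ℝ) {m : ℕ} {L : List (ℕ × ℕ)} (hL : ValidEdges m L) :
    plattIndex α (starWith (m + 1) L) =
      ∑ i ∈ Finset.range m, ((m : ℝ) - 1 + incidence L (i + 1)) ^ α +
      (L.map fun p => ((incidence L p.1 : ℝ) + incidence L p.2) ^ α).sum := by
  have hd (x : ℕ) : ((if x = 0 then m else 1 : ℕ) : ℝ) = if x = 0 then (m : ℝ) else 1 := by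
    split_ifs <;> simp
  rw [plattIndex, sum_edgeFinset_starWith hL _ (fun a b =>
    (((if a = 0 then (m : ℝ) else 1) + incidence L a) +
      ((if b = 0 then (m : ℝ) else 1) + incidence L b) - 2) ^ α)]
  · congr 1
    · refine Finset.sum_congr rfl fun i _ => ?_
      rw [incidence_zero hL, if_pos rfl, if_neg (Nat.succ_ne_zero i)]
      congr 1
      push_cast
      ring
    · congr 1
      refine List.map_congr_left fun p hp => ?_
      have := hL.2 p hp
      rw [if_neg (by lia), if_neg (by lia)]
      congr 1
      ring
  · intro x y _
    simp only [Sym2.lift_mk, degree_starWith hL, Nat.cast_add, hd]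

lemma eq_starWith_of_le {m : ℕ} {L : List (ℕ × ℕ)} (hL : ValidEdges m L)
    {G : SimpleGraph (Fin (m + 1))} (hG : IsCyclicGraph L.length G) (h : starWith (m + 1) L ≤ G) :
    G = starWith (m + 1) L := by
  have h2 := hG.2
  rw [Fintype.card_fin] at h2
  refine (SimpleGraph.edgeSet_injective (Set.eq_of_subset_of_ncard_le
    (SimpleGraph.edgeSet_mono h) ?_ (Set.toFinite _))).symm
  rw [ncard_edgeSet_starWith hL]
  lia

lemma IsCyclicGraph.not_le_starWith {k m : ℕ} {L : List (ℕ × ℕ)} (hL : ValidEdges m L)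
    {G : SimpleGraph (Fin (m + 1))} (hG : IsCyclicGraph k G) (hk : L.length < k) :
    ¬ G ≤ starWith (m + 1) L := by
  intro h
  have h2 := hG.2
  rw [Fintype.card_fin] at h2
  have := Set.ncard_le_ncard (SimpleGraph.edgeSet_mono h) (Set.toFinite _)
  rw [ncard_edgeSet_starWith hL] at this
  lia

/-! ### Reduction to shifted graphs. -/

/-- A graph on `0, …, m` with dominating vertex `0` whose neighbourhoods decrease with the index. -/
structure IsShifted {m : ℕ} (G : SimpleGraph (Fin (m + 1))) : Prop where
  adj_zero : ∀ i, i ≠ 0 → G.Adj 0 i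
  adj_of_lt : ∀ i j y, i < j → y ≠ i → G.Adj j y → G.Adj i y

-- Sorting by degree makes nestedness follow the index order. Once `0` is known to be adjacent to
-- every other vertex, it is a common neighbour of any two others, so the side condition of
-- `exists_nested` always holds.
open Classical in
lemma IsCyclicGraph.exists_isShifted {α : ℝ} (hα : 1 ≤ α) {k m : ℕ} {V : Type*} [Fintype V]
    {G : SimpleGraph V} (hV : Fintype.card V = m + 1) (hG : IsCyclicGraph k G) :
    ∃ H : SimpleGraph (Fin (m + 1)), IsCyclicGraph k H ∧ plattIndex α G ≤ plattIndex α H ∧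
      IsShifted H := by
  obtain ⟨K, hK, hle, hnest⟩ := hG.exists_nested hα
  let e₀ : Fin (m + 1) ≃ V := (Fintype.equivFinOfCardEq hV).symm
  -- The order dual makes `Tuple.sort` list the degrees in decreasing order.
  let d : Fin (m + 1) → ℕᵒᵈ := fun i => OrderDual.toDual (K.degree (e₀ i))
  let e : Fin (m + 1) ≃ V := (Tuple.sort d).trans e₀
  have hmono : ∀ i j, i ≤ j → K.degree (e j) ≤ K.degree (e i) := fun i j hij =>
    Tuple.monotone_sort d hij
  let H := K.comap e
  have hHK : ∀ i j, H.Adj i j ↔ K.Adj (e i) (e j) := fun i j => Iff.rfl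
  let φ : H ≃g K := SimpleGraph.Iso.comap e K
  have hH : IsCyclicGraph k H := hK.congr_iso φ.symm
  have hnest' : ∀ i j, i < j → (H.Adj i j ∨ ∃ c, H.Adj i c ∧ H.Adj j c) →
      ∀ y, y ≠ i → H.Adj j y → H.Adj i y := by
    intro i j hij hc y hy hjy
    refine hnest (e i) (e j) (e.injective.ne hij.ne) (hmono _ _ hij.le) ?_ (e y)
      (e.injective.ne hy) hjy
    exact hc.imp id fun ⟨c, h1, h2⟩ => ⟨e c, h1, h2⟩
  have hzero : ∀ i, i ≠ 0 → H.Adj 0 i := by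
    -- A neighbour `u` of `0` has no private neighbour with respect to `0`, so adjacency to `0`
    -- propagates along walks.
    have key : ∀ u v, H.Walk u v → (u = 0 ∨ H.Adj 0 u) → v = 0 ∨ H.Adj 0 v := by
      intro u v p
      induction p with
      | nil => exact id
      | @cons u w v h _ ih =>
        intro hu
        apply ih
        rcases hu with rfl | hu
        · exact .inr h
        · by_cases hw : w = 0
          · exact .inl hw
          · exact .inr (hnest' 0 u (Fin.pos_iff_ne_zero.2 hu.ne') (.inl hu) w hw h)
    intro i hi
    obtain ⟨p⟩ := hH.1.preconnected 0 i
    exact (key _ _ p (.inl rfl)).resolve_left hi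
  refine ⟨H, hH, hle.trans_eq (plattIndex_congr_iso α φ.symm), hzero, fun i j y hij hy hjy => ?_⟩
  by_cases hi : i = 0
  · subst hi; exact hzero y hy
  · exact hnest' i j hij (.inr ⟨0, (hzero i hi).symm, (hzero j (by
      rintro rfl; exact absurd hij (Fin.not_lt_zero _))).symm⟩) y hy hjy

/-! ### Second differences of `x ^ α` and the two comparisons. -/

/-- The second difference of `x ^ α`. -/
noncomputable def secondDiffRpow (α x : ℝ) : ℝ := (x + 2) ^ α - 2 * (x + 1) ^ α + x ^ α

lemma secondDiffRpow_nonneg {α x : ℝ} (hα : 1 ≤ α) (hx : 0 ≤ x) : 0 ≤ secondDiffRpow α x := by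
  have h := rpow_add_le_of_spread (x := x + 1) (y := x + 1) (s := 1) hα (by linarith)
    zero_le_one le_rfl
  rw [show x + 1 + 1 = x + 2 by ring, show x + 1 - 1 = x by ring] at h
  unfold secondDiffRpow
  linarith

lemma hasDerivAt_secondDiffRpow (α : ℝ) {x : ℝ} (hx : 0 < x) :
    HasDerivAt (secondDiffRpow α) (α * secondDiffRpow (α - 1) x) x := by
  have h (c : ℝ) (hc : 0 ≤ c) :
      HasDerivAt (fun y : ℝ => (y + c) ^ α) (α * (x + c) ^ (α - 1)) x := by
    have := ((hasDerivAt_id x).add_const c).rpow_const (p := α) (.inl (by simp; linarith))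
    simpa using this
  have h0 := h 0 le_rfl
  simp only [add_zero] at h0
  have := ((h 2 (by norm_num)).sub ((h 1 (by norm_num)).const_mul 2)).add h0
  refine this.congr_deriv ?_
  unfold secondDiffRpow
  ring

lemma continuousOn_secondDiffRpow {α : ℝ} (hα : 1 < α) :
    ContinuousOn (secondDiffRpow α) (Set.Ici 0) := by
  have h (c : ℝ) : Continuous fun y : ℝ => (y + c) ^ α :=
    (continuous_id.add continuous_const).rpow_const fun _ => .inr (by linarith)
  have h0 := h 0
  simp only [add_zero] at h0
  exact (((h 2).sub ((h 1).const_smul (2 : ℝ))).add h0).continuousOn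

/-- The derivative is `α` times the second difference of `x ^ (α - 1)`, which is negative by strict
concavity since `0 < α - 1 < 1`. -/
lemma secondDiffRpow_strictAntiOn {α : ℝ} (h1 : 1 < α) (h2 : α < 2) :
    StrictAntiOn (secondDiffRpow α) (Set.Ici 0) := by
  refine strictAntiOn_of_deriv_neg (convex_Ici 0) (continuousOn_secondDiffRpow h1) fun x hx => ?_
  rw [interior_Ici, Set.mem_Ioi] at hx
  rw [(hasDerivAt_secondDiffRpow α hx).deriv]
  have hx2 : x + 2 ∈ Set.Ici (0 : ℝ) := by simp only [Set.mem_Ici]; linarith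
  have h := (Real.strictConcaveOn_rpow (p := α - 1) (by linarith) (by linarith)).2
    (Set.mem_Ici.2 hx.le) hx2 (by linarith : x < x + 2).ne
    (one_half_pos (α := ℝ)) (one_half_pos (α := ℝ)) (by norm_num)
  simp only [smul_eq_mul] at h
  rw [show 1 / 2 * x + 1 / 2 * (x + 2) = x + 1 by ring] at h
  refine mul_neg_of_pos_of_neg (by linarith) ?_
  unfold secondDiffRpow
  linarith

lemma secondDiffRpow_strictMonoOn {α : ℝ} (h2 : 2 < α) :
    StrictMonoOn (secondDiffRpow α) (Set.Ici 0) := by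
  refine strictMonoOn_of_deriv_pos (convex_Ici 0)
    (continuousOn_secondDiffRpow (by linarith)) fun x hx => ?_
  rw [interior_Ici, Set.mem_Ioi] at hx
  rw [(hasDerivAt_secondDiffRpow α hx).deriv]
  have hx2 : x + 2 ∈ Set.Ici (0 : ℝ) := by simp only [Set.mem_Ici]; linarith
  have h := (strictConvexOn_rpow (p := α - 1) (by linarith)).2
    (Set.mem_Ici.2 hx.le) hx2 (by linarith : x < x + 2).ne
    (one_half_pos (α := ℝ)) (one_half_pos (α := ℝ)) (by norm_num)
  simp only [smul_eq_mul] at h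
  rw [show 1 / 2 * x + 1 / 2 * (x + 2) = x + 1 by ring] at h
  refine mul_pos (by linarith) ?_
  unfold secondDiffRpow
  linarith

lemma secondDiffRpow_eq {α : ℝ} (h : α = 1 ∨ α = 2) (x y : ℝ) :
    secondDiffRpow α x = secondDiffRpow α y := by
  unfold secondDiffRpow
  rcases h with rfl | rfl
  · simp only [Real.rpow_one]; ring
  · simp only [Real.rpow_two]; ring

/-- For `α > 2` monotonicity suffices. For `1 < α < 2` the left side is at most its value `2 ^ α - 2
≤ 2` at `0`, while `5 ^ α - 4 ^ α ≥ 1`. -/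
lemma secondDiffRpow_sub_le {α x : ℝ} (hα : 1 ≤ α) (hx : 0 ≤ x) :
    secondDiffRpow α x ≤ secondDiffRpow α (x + 1) + 2 * (5 ^ α - 4 ^ α) := by
  have h54 : (4 : ℝ) ^ α + 1 ≤ 5 ^ α := by
    have h := rpow_add_le_of_spread (x := 4) (y := 1) (s := 1) hα (by norm_num)
      zero_le_one (by norm_num)
    rw [Real.one_rpow, sub_self, Real.zero_rpow (by linarith), add_zero] at h
    convert h using 2
    norm_num
  by_cases h12 : α = 1 ∨ α = 2
  · rw [secondDiffRpow_eq h12 x (x + 1)]; linarith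
  push Not at h12
  rcases lt_or_ge α 2 with h2 | h2
  · have h1 : 1 < α := lt_of_le_of_ne hα (Ne.symm h12.1)
    have h0 := (secondDiffRpow_strictAntiOn h1 h2).antitoneOn (Set.mem_Ici.2 le_rfl)
      (Set.mem_Ici.2 hx) hx
    have hnn := secondDiffRpow_nonneg (x := x + 1) hα (by linarith)
    have h4 : (2 : ℝ) ^ α ≤ 2 ^ (2 : ℝ) := Real.rpow_le_rpow_of_exponent_le (by norm_num) h2.le
    have hz : secondDiffRpow α 0 = 2 ^ α - 2 := by
      simp [secondDiffRpow, Real.zero_rpow (by linarith : α ≠ 0)]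
    rw [Real.rpow_two] at h4
    linarith
  · have h2' : 2 < α := lt_of_le_of_ne h2 (Ne.symm h12.2)
    have := (secondDiffRpow_strictMonoOn h2').monotoneOn (Set.mem_Ici.2 hx)
      (Set.mem_Ici.2 (by linarith : 0 ≤ x + 1)) (by linarith)
    linarith

lemma plattIndex_graphG4_sub_graphG5 (α : ℝ) {m : ℕ} (hm : 4 ≤ m) :
    plattIndex α (graphG4 (m + 1)) - plattIndex α (graphG5 (m + 1)) =
      secondDiffRpow α (m - 1 + 1) - secondDiffRpow α (m - 1) := by
  -- Pendent vertices with index above `4` meet no added edge in either graph, so the tails of the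
  -- two sums cancel.
  obtain ⟨r, rfl⟩ := Nat.exists_eq_add_of_le hm
  have hr (x : ℕ) : 4 + x ≠ 1 ∧ 4 + x ≠ 2 ∧ 4 + x ≠ 3 := by lia
  rw [graphG4, graphG5,
    plattIndex_starWith α (by simp [ValidEdges]; lia),
    plattIndex_starWith α (by simp [ValidEdges]; lia)]
  simp only [Finset.sum_range_add, Finset.sum_range_succ, Finset.sum_range_zero, secondDiffRpow,
    incidence]
  simp [hr]
  ring_nf

lemma plattIndex_graphH4_sub_graphH5 (α : ℝ) {m : ℕ} (hm : 5 ≤ m) :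
    plattIndex α (graphH4 (m + 1)) - plattIndex α (graphH5 (m + 1)) =
      secondDiffRpow α (m - 1 + 1 + 1) + secondDiffRpow α (m - 1 + 1) - secondDiffRpow α (m - 1) +
        2 * (5 ^ α - 4 ^ α) := by
  obtain ⟨r, rfl⟩ := Nat.exists_eq_add_of_le hm
  have hr (x : ℕ) : 5 + x ≠ 1 ∧ 5 + x ≠ 2 ∧ 5 + x ≠ 3 ∧ 5 + x ≠ 4 := by lia
  rw [graphH4, graphH5,
    plattIndex_starWith α (by simp [ValidEdges]; lia),
    plattIndex_starWith α (by simp [ValidEdges]; lia)]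
  simp only [Finset.sum_range_add, Finset.sum_range_succ, Finset.sum_range_zero, secondDiffRpow,
    incidence]
  simp [hr]
  ring_nf

/-! ### Classification of shifted graphs with few added edges. -/

section Shifted
variable {m : ℕ} {G : SimpleGraph (Fin (m + 1))}

/-- Adjacency of the vertices with the given indices. -/
def AdjIdx (G : SimpleGraph (Fin (m + 1))) (i j : ℕ) : Prop :=
  ∃ x y : Fin (m + 1), x.val = i ∧ y.val = j ∧ G.Adj x y

/-- The index pairs of edges form a down-set, so one edge forces all those below it and one missing
pair excludes all those above it. -/
lemma IsShifted.mono (h : IsShifted G) {x y x' y' : ℕ} (hA : AdjIdx G x y) (hxy : x < y)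
    (hx : x' ≤ x) (hy : y' ≤ y) (hxy' : x' < y') : AdjIdx G x' y' := by
  obtain ⟨u, v, rfl, rfl, huv⟩ := hA
  have hu := u.isLt
  have hv := v.isLt
  let u' : Fin (m + 1) := ⟨x', by lia⟩
  let v' : Fin (m + 1) := ⟨y', by lia⟩
  have h1 : G.Adj u' v := by
    rcases hx.eq_or_lt with he | hlt
    · rwa [show u' = u from Fin.ext he]
    · exact h.adj_of_lt u' u v hlt (Fin.ne_of_gt (show x' < v.val by lia)) huv
  refine ⟨u', v', rfl, rfl, ?_⟩
  rcases hy.eq_or_lt with he | hlt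
  · rwa [show v' = v from Fin.ext he]
  · exact (h.adj_of_lt v' v u' hlt (Fin.ne_of_lt hxy') h1.symm).symm

lemma IsShifted.starWith_le (h : IsShifted G) {L : List (ℕ × ℕ)}
    (hL : ∀ p ∈ L, AdjIdx G p.1 p.2) : starWith (m + 1) L ≤ G := by
  have key : ∀ x y : Fin (m + 1), x ≠ y → (x.val = 0 ∨ (x.val, y.val) ∈ L) → G.Adj x y := by
    rintro x y hne (hx | hx)
    · obtain rfl : x = 0 := Fin.ext hx
      exact h.adj_zero y hne.symm
    · obtain ⟨u, v, hu, hv, huv⟩ := hL _ hx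
      rwa [Fin.ext hu, Fin.ext hv] at huv
  intro x y hxy
  obtain ⟨hne, hx | hy⟩ := starWith_adj.1 hxy
  · exact key x y hne hx
  · exact (key y x hne.symm hy).symm

lemma le_starWith {L : List (ℕ × ℕ)}
    (hL : ∀ x y, 1 ≤ x → x < y → AdjIdx G x y → (x, y) ∈ L) : G ≤ starWith (m + 1) L := by
  intro x y hxy
  have hne : x.val ≠ y.val := fun h => hxy.ne (Fin.ext h)
  refine starWith_adj.2 ⟨hxy.ne, ?_⟩
  by_cases hx : x.val = 0
  · exact .inl (.inl hx)
  by_cases hy : y.val = 0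
  · exact .inr (.inl hy)
  rcases lt_or_gt_of_ne hne with hlt | hlt
  · exact .inl (.inr (hL _ _ (by lia) hlt ⟨x, y, rfl, rfl, hxy⟩))
  · exact .inr (.inr (hL _ _ (by lia) hlt ⟨y, x, rfl, rfl, hxy.symm⟩))

lemma IsShifted.eq_graphS (h : IsShifted G) (hG : IsCyclicGraph 0 G) : G = graphS (m + 1) :=
  eq_starWith_of_le (by simp [ValidEdges]) hG (h.starWith_le (by simp))

lemma IsShifted.eq_graphSPlus (h : IsShifted G) (hm : 2 ≤ m) (hG : IsCyclicGraph 1 G) :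
    G = graphSPlus (m + 1) := by
  have h12 : AdjIdx G 1 2 := by
    by_contra hn
    exact hG.not_le_starWith (L := []) (by simp [ValidEdges]) (by simp)
      (le_starWith fun x y h1 h2 hA => absurd (h.mono hA h2 (by lia) (by lia) (by lia)) hn)
  exact eq_starWith_of_le (by simp [ValidEdges]; lia) hG (h.starWith_le (by simpa))

lemma IsShifted.eq_graphB1 (h : IsShifted G) (hm : 3 ≤ m) (hG : IsCyclicGraph 2 G) :
    G = graphB1 (m + 1) := by
  have h13 : AdjIdx G 1 3 := by
    by_contra hn
    refine hG.not_le_starWith (L := [(1, 2)]) (by simp [ValidEdges]; lia) (by simp)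
      (le_starWith fun x y h1 h2 hA => ?_)
    have hy : y ≤ 2 := by
      by_contra hy
      exact hn (h.mono hA h2 (by lia) (by lia) (by lia))
    simp only [List.mem_singleton, Prod.mk.injEq]
    lia
  have h12 : AdjIdx G 1 2 := h.mono h13 (by lia) le_rfl (by lia) (by lia)
  exact eq_starWith_of_le (by simp [ValidEdges]; lia) hG (h.starWith_le (by simp [h12, h13]))

/-- If `(1, 4)` is present, so are the two pairs below it, which makes three. Otherwise all pairs
lie in `{1, 2, 3}`, and all three are needed. -/
lemma IsShifted.eq_graphG4_or_graphG5 (h : IsShifted G) (hm : 4 ≤ m) (hG : IsCyclicGraph 3 G) :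
    G = graphG4 (m + 1) ∨ G = graphG5 (m + 1) := by
  by_cases h14 : AdjIdx G 1 4
  · have h13 : AdjIdx G 1 3 := h.mono h14 (by lia) le_rfl (by lia) (by lia)
    have h12 : AdjIdx G 1 2 := h.mono h14 (by lia) le_rfl (by lia) (by lia)
    exact .inl (eq_starWith_of_le (by simp [ValidEdges]; lia) hG
      (h.starWith_le (by simp [h12, h13, h14])))
  have h23 : AdjIdx G 2 3 := by
    by_contra hn
    refine hG.not_le_starWith (L := [(1, 2), (1, 3)]) (by simp [ValidEdges]; lia) (by simp)
      (le_starWith fun x y h1 h2 hA => ?_)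
    have hy : y ≤ 3 := by
      by_contra hy
      exact h14 (h.mono hA h2 (by lia) (by lia) (by lia))
    have hx : x ≤ 1 := by
      by_contra hx
      exact hn (h.mono hA h2 (by lia) (by lia) (by lia))
    simp only [List.mem_cons, Prod.mk.injEq, List.not_mem_nil, or_false]
    lia
  have h13 : AdjIdx G 1 3 := h.mono h23 (by lia) (by lia) (by lia) (by lia)
  have h12 : AdjIdx G 1 2 := h.mono h23 (by lia) (by lia) (by lia) (by lia)
  exact .inr (eq_starWith_of_le (by simp [ValidEdges]; lia) hG
    (h.starWith_le (by simp [h12, h13, h23])))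

/-- The split is on `(1, 5)`, which can be present only if `5 ≤ m`; hence `H_5` is the only
candidate on five vertices. Without `(1, 5)`, omitting `(2, 3)` or `(1, 4)` leaves at most three
pairs. -/
lemma IsShifted.eq_graphH4_or_graphH5 (h : IsShifted G) (hm : 4 ≤ m) (hG : IsCyclicGraph 4 G) :
    (5 ≤ m ∧ G = graphH4 (m + 1)) ∨ G = graphH5 (m + 1) := by
  by_cases h15 : AdjIdx G 1 5
  · have h14 : AdjIdx G 1 4 := h.mono h15 (by lia) le_rfl (by lia) (by lia)
    have h13 : AdjIdx G 1 3 := h.mono h15 (by lia) le_rfl (by lia) (by lia)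
    have h12 : AdjIdx G 1 2 := h.mono h15 (by lia) le_rfl (by lia) (by lia)
    have hm5 : 5 ≤ m := by
      obtain ⟨_, v, _, hv, _⟩ := h15
      lia
    exact .inl ⟨hm5, eq_starWith_of_le (by simp [ValidEdges]; lia) hG
      (h.starWith_le (by simp [h12, h13, h14, h15]))⟩
  have h23 : AdjIdx G 2 3 := by
    by_contra hn
    refine hG.not_le_starWith (L := [(1, 2), (1, 3), (1, 4)]) (by simp [ValidEdges]; lia) (by simp)
      (le_starWith fun x y h1 h2 hA => ?_)
    have hy : y ≤ 4 := by
      by_contra hy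
      exact h15 (h.mono hA h2 (by lia) (by lia) (by lia))
    have hx : x ≤ 1 := by
      by_contra hx
      exact hn (h.mono hA h2 (by lia) (by lia) (by lia))
    simp only [List.mem_cons, Prod.mk.injEq, List.not_mem_nil, or_false]
    lia
  have h14 : AdjIdx G 1 4 := by
    by_contra hn
    refine hG.not_le_starWith (L := [(1, 2), (1, 3), (2, 3)]) (by simp [ValidEdges]; lia) (by simp)
      (le_starWith fun x y h1 h2 hA => ?_)
    have hy : y ≤ 3 := by
      by_contra hy
      exact hn (h.mono hA h2 (by lia) (by lia) (by lia))
    simp only [List.mem_cons, Prod.mk.injEq, List.not_mem_nil, or_false]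
    lia
  have h13 : AdjIdx G 1 3 := h.mono h23 (by lia) (by lia) (by lia) (by lia)
  have h12 : AdjIdx G 1 2 := h.mono h23 (by lia) (by lia) (by lia) (by lia)
  exact .inr (eq_starWith_of_le (by simp [ValidEdges]; lia) hG
    (h.starWith_le (by simp [h12, h13, h14, h23])))

end Shifted

/-! ### The extremal graphs. -/

lemma hasMaxPlatt_of_isShifted {α : ℝ} (hα : 1 ≤ α) {k m : ℕ} {G₀ : SimpleGraph (Fin (m + 1))}
    (hG₀ : IsCyclicGraph k G₀)
    (h : ∀ G : SimpleGraph (Fin (m + 1)), IsCyclicGraph k G → IsShifted G →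
      plattIndex α G ≤ plattIndex α G₀) : HasMaxPlatt.{u} α k (m + 1) G₀ := by
  refine ⟨hG₀, fun V _ G hV hG => ?_⟩
  obtain ⟨H, hH, hle, hs⟩ := hG.exists_isShifted hα hV
  exact hle.trans (h H hH hs)

theorem theorem7 (α : ℝ) (hα : 1 ≤ α) (n : ℕ) :
    -- trees, unicyclic and bicyclic graphs
    (1 ≤ n → HasMaxPlatt.{u} α 0 n (graphS n)) ∧
    (3 ≤ n → HasMaxPlatt.{u} α 1 n (graphSPlus n)) ∧
    (4 ≤ n → HasMaxPlatt.{u} α 2 n (graphB1 n)) ∧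
    -- tricyclic graphs
    (5 ≤ n →
      (HasMaxPlatt.{u} α 3 n (graphG4 n) ∨ HasMaxPlatt.{u} α 3 n (graphG5 n)) ∧
      (1 < α → α < 2 → plattIndex α (graphG4 n) < plattIndex α (graphG5 n)) ∧
      (2 < α → plattIndex α (graphG5 n) < plattIndex α (graphG4 n)) ∧
      (α = 1 ∨ α = 2 → plattIndex α (graphG4 n) = plattIndex α (graphG5 n))) ∧
    -- tetracyclic graphs
    (6 ≤ n → HasMaxPlatt.{u} α 4 n (graphH4 n)) ∧
    (n = 5 → HasMaxPlatt.{u} α 4 n (graphH5 n)) := by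
  rcases n with _ | m
  · simp
  refine ⟨fun _ => ?_, fun hn => ?_, fun hn => ?_, fun hn => ⟨?_, fun h1 h2 => ?_, fun h2 => ?_,
    fun h12 => ?_⟩, fun hn => ?_, fun hn => ?_⟩
  · exact hasMaxPlatt_of_isShifted hα (isCyclicGraph_starWith (L := []) (by simp [ValidEdges]))
      fun G hG hs => by rw [hs.eq_graphS hG]
  · exact hasMaxPlatt_of_isShifted hα
      (isCyclicGraph_starWith (L := [(1, 2)]) (by simp [ValidEdges]; lia))
      fun G hG hs => by rw [hs.eq_graphSPlus (by lia) hG]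
  · exact hasMaxPlatt_of_isShifted hα
      (isCyclicGraph_starWith (L := [(1, 2), (1, 3)]) (by simp [ValidEdges]; lia))
      fun G hG hs => by rw [hs.eq_graphB1 (by lia) hG]
  · rcases le_total (plattIndex α (graphG5 (m + 1))) (plattIndex α (graphG4 (m + 1))) with h | h
    · refine .inl (hasMaxPlatt_of_isShifted hα (isCyclicGraph_starWith
        (L := [(1, 2), (1, 3), (1, 4)]) (by simp [ValidEdges]; lia)) fun G hG hs => ?_)
      rcases hs.eq_graphG4_or_graphG5 (by lia) hG with rfl | rfl
      exacts [le_rfl, h]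
    · refine .inr (hasMaxPlatt_of_isShifted hα (isCyclicGraph_starWith
        (L := [(1, 2), (1, 3), (2, 3)]) (by simp [ValidEdges]; lia)) fun G hG hs => ?_)
      rcases hs.eq_graphG4_or_graphG5 (by lia) hG with rfl | rfl
      exacts [h, le_rfl]
  · have hm : (4 : ℝ) ≤ m := by exact_mod_cast (by lia : 4 ≤ m)
    have h := plattIndex_graphG4_sub_graphG5 α (m := m) (by lia)
    have := secondDiffRpow_strictAntiOn h1 h2
      (Set.mem_Ici.2 (by linarith : 0 ≤ (m : ℝ) - 1))
      (Set.mem_Ici.2 (by linarith : 0 ≤ (m : ℝ) - 1 + 1)) (by linarith)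
    linarith
  · have hm : (4 : ℝ) ≤ m := by exact_mod_cast (by lia : 4 ≤ m)
    have h := plattIndex_graphG4_sub_graphG5 α (m := m) (by lia)
    have := secondDiffRpow_strictMonoOn h2
      (Set.mem_Ici.2 (by linarith : 0 ≤ (m : ℝ) - 1))
      (Set.mem_Ici.2 (by linarith : 0 ≤ (m : ℝ) - 1 + 1)) (by linarith)
    linarith
  · have h := plattIndex_graphG4_sub_graphG5 α (m := m) (by lia)
    have := secondDiffRpow_eq h12 ((m : ℝ) - 1) (m - 1 + 1)
    linarith
  · refine hasMaxPlatt_of_isShifted hα (isCyclicGraph_starWith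
      (L := [(1, 2), (1, 3), (1, 4), (1, 5)]) (by simp [ValidEdges]; lia)) fun G hG hs => ?_
    rcases hs.eq_graphH4_or_graphH5 (by lia) hG with ⟨_, rfl⟩ | rfl
    · exact le_rfl
    · have hm : (5 : ℝ) ≤ m := by exact_mod_cast (by lia : 5 ≤ m)
      have h := plattIndex_graphH4_sub_graphH5 α (m := m) (by lia)
      -- In the formula `h`, the leading second difference is nonnegative, and
      -- `secondDiffRpow_sub_le` bounds the rest from below by `0`.
      have h1 := secondDiffRpow_sub_le (x := (m : ℝ) - 1) hα (by linarith)
      have h2 := secondDiffRpow_nonneg (x := (m : ℝ) - 1 + 1 + 1) hα (by linarith)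
      change plattIndex α (graphH5 (m + 1)) ≤ plattIndex α (graphH4 (m + 1))
      linarith
  · refine hasMaxPlatt_of_isShifted hα (isCyclicGraph_starWith
      (L := [(1, 2), (1, 3), (2, 3), (1, 4)]) (by simp [ValidEdges]; lia)) fun G hG hs => ?_
    rcases hs.eq_graphH4_or_graphH5 (by lia) hG with ⟨h5, _⟩ | rfl
    · lia
    · exact le_rfl
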